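/- Let $G$ be a finite connected simple graph of order $n$. For vertices $u,v$ let $D(u,v)$ (the detour distance) be the length of a longest path between $u$ and $v$. A hamiltonian coloring of $G$ is a map $c:V(G)\to\{0,1,2,\dots\}$ with $D(u,v)+|c(u)-c(v)|\ge n-1$ for all distinct vertices $u,v$, and the hamiltonian chromatic number $hc(G)$ is the minimum over all hamiltonian colorings $c$ of $G$ of $\max_{v\in V(G)}c(v)$. Let $r,m\ge 1$, $k_i\ge 1$ and $m_i\ge 2$ $(1\le i\le r)$ be integers. The level-wise regular block graph $G^{1}=G^{1}_{k_1m_1,\dots,k_rm_r}$ is obtained from a single vertex $w$ as follows: attach $k_1$ blocks (complete graphs) of size $m_1+1$ to $w$, then attach $k_2$ blocks of size $m_2+1$ to each of the $k_1m_1$ new vertices, and so on, until finally $k_r$ blocks of size $m_r+1$ are attached to each of the vertices added in step $r-1$. The graph $G^{m+1}=G^{m+1}_{k_1m_1,\dots,k_rm_r}$ is obtained by the same procedure starting from a complete graph on $m+1$ vertices $w^0,\dots,w^m$, where in the first step $k_1$ blocks of size $m_1+1$ are attached to each $w^t$. (1) If $k_1\ge 2$, and $k_1\ge 3$ in case $r=1$,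 then $$hc(G^{1})=\left[\sum_{i=1}^{r}\prod_{j=1}^{i}k_jm_j\right]^{2}-2\left[\sum_{i=1}^{r}\left(\prod_{j=1}^{i}k_jm_j\right)\left(\sum_{j=1}^{i}m_j\right)\right]+m_1 .$$ (2) If $(m+1)k_1\ge 3$ in case $r=1$ (for $r\ge 2$ nothing further is required), then $$hc(G^{m+1})=\left[m+(m+1)\sum_{i=1}^{r}\prod_{j=1}^{i}k_jm_j\right]\left[(m+1)\sum_{i=1}^{r}\prod_{j=1}^{i}k_jm_j\right]-2\left[\sum_{i=1}^{r}(m+1)\left(\prod_{j=1}^{i}k_jm_j\right)\left(\sum_{j=1}^{i}m_j\right)\right].$$ -/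

import Mathlib

/-- The detour distance `D(u, v)`: the length of a longest path between `u` and `v`.
In a finite connected graph the set of lengths is non-empty and bounded, so the supremum is a
maximum. -/
noncomputable def detourDist {V : Type*} (G : SimpleGraph V) (u v : V) : ℕ :=
  sSup {n : ℕ | ∃ p : G.Walk u v, p.IsPath ∧ p.length = n}

/-- A hamiltonian coloring of a graph of order `n` assigns to the vertices non-negative integers
such that `D(u, v) + |c(u) - c(v)| ≥ n - 1` for all distinct vertices `u` and `v`. -/
def IsHamiltonianColoring {V : Type*} [Fintype V] (G : SimpleGraph V) (c : V → ℕ) : Prop :=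
  ∀ u v : V, u ≠ v →
    (detourDist G u v : ℤ) + |(c u : ℤ) - (c v : ℤ)| ≥ (Fintype.card V : ℤ) - 1

/-- The hamiltonian chromatic number: the minimum, over all hamiltonian colorings `c`, of the
maximum color used by `c`. -/
noncomputable def hamiltonianChromaticNumber {V : Type*} [Fintype V] (G : SimpleGraph V) : ℕ :=
  sInf {s : ℕ | ∃ c : V → ℕ, IsHamiltonianColoring G c ∧ Finset.univ.sup c = s}

/-- Vertices of the level-wise regular block graph with `w` central vertices and `r` levels.
A vertex of level `l` is reached from a central vertex by `l` steps; step `i + 1` selects one of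
the `k (i + 1)` blocks attached to the current vertex, and then one of the `m (i + 1)` vertices of
that block other than the current vertex. -/
abbrev LevelVertex (w r : ℕ) (k m : ℕ → ℕ) : Type :=
  Σ l : Fin (r + 1), Fin w × ((i : Fin l) → Fin (k (i + 1)) × Fin (m (i + 1)))

namespace LevelVertex

variable {w r : ℕ} {k m : ℕ → ℕ}

/-- The level of a vertex (`0` for the central vertices). -/
def level (u : LevelVertex w r k m) : ℕ := u.1

/-- The central vertex from which `u` is reached. -/
def root (u : LevelVertex w r k m) : Fin w := u.2.1

/-- The choice (block, vertex of the block) made in step `i + 1` on the way to `u`. -/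
def step (u : LevelVertex w r k m) (i : ℕ) (hi : i < u.level) :
    Fin (k (i + 1)) × Fin (m (i + 1)) := u.2.2 ⟨i, hi⟩

/-- `v` is one of the vertices of the blocks attached to `u`, that is, a child of `u`. -/
def IsChild (u v : LevelVertex w r k m) : Prop :=
  v.level = u.level + 1 ∧ v.root = u.root ∧
    ∀ (i : ℕ) (hu : i < u.level) (hv : i < v.level), v.step i hv = u.step i hu

/-- `u` and `v` are two children of one vertex which lie in the same block attached to it. -/
def IsSibling (u v : LevelVertex w r k m) : Prop :=
  u ≠ v ∧ u.root = v.root ∧ ∃ l : ℕ, ∃ (hu : u.level = l + 1) (hv : v.level = l + 1),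
    (∀ (i : ℕ) (hi : i < l), u.step i (by omega) = v.step i (by omega)) ∧
      (u.step l (by omega)).1 = (v.step l (by omega)).1

end LevelVertex

/-- The level-wise regular block graph: a complete graph on `w` central vertices, with `k 1` blocks
of size `m 1 + 1` attached to each of them, `k 2` blocks of size `m 2 + 1` attached to each of the
end vertices so obtained, and so on up to `k r` blocks of size `m r + 1`.
(`SimpleGraph.fromRel` makes the relation symmetric.) -/
def levelGraph (w r : ℕ) (k m : ℕ → ℕ) : SimpleGraph (LevelVertex w r k m) :=
  SimpleGraph.fromRel fun u v =>
    (u.level = 0 ∧ v.level = 0) ∨ u.IsChild v ∨ u.IsSibling v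

/-! Let M + 1 be the number of central vertices, P the number of other vertices, L(v) the sum of the
block parameters m i over the levels between v and the centre (`depth`), and X its upper bound
`levelSum m r`. Blocks hang on cut vertices, so a path from u to v can use only central vertices and
the blocks on the two chains leading from u and v to the centre. Hence D(u,v) ≤ L(u) + L(v) + M
(`detourDist_levelGraph_le`). Equality holds if u and v lie over different central vertices, or if M
= 0 and their chains start in different blocks.

Lower bound (`IsHamiltonianColoring.le_sup`): order the vertices by color. Consecutive colors differ
by at least P - L(u) - L(v). In the telescoped sum every vertex counts twice except the two ends,
which count once. So the span is at least (P + M)P - 2∑L + L(first) + L(last). The end terms can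
vanish if there are two central vertices; if there is only one, they contribute at least m 1.

Upper bound (`exists_isHamiltonianColoring`): it suffices to find an order in which all these
inequalities are equalities and the resulting coloring is hamiltonian. The order `pos` cycles
through the central vertices, then through the blocks at each of them, then through the vertices of
each block, so neighbours in the order attain the detour bound. At position distance two a moderate
loss in D is affordable, and from three on the color gaps need only D ≥ 2 for pairs not both
central. The numerical conditions for this reduce to comparing X with P. They hold for r ≥ 2 because
products outgrow sums; for r = 1 they need the extra hypotheses on k 1. -/

theorem detourDist_comm {V : Type*} (G : SimpleGraph V) (u v : V) :
    detourDist G u v = detourDist G v u := by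
  unfold detourDist
  congr 1
  ext n
  constructor
  · rintro ⟨p, hp, rfl⟩
    exact ⟨p.reverse, hp.reverse, by simp⟩
  · rintro ⟨p, hp, rfl⟩
    exact ⟨p.reverse, hp.reverse, by simp⟩

theorem SimpleGraph.Walk.IsPath.length_le_detourDist {V : Type*} [Fintype V] {G : SimpleGraph V}
    {u v : V} {p : G.Walk u v} (hp : p.IsPath) : p.length ≤ detourDist G u v := by
  refine le_csSup ⟨Fintype.card V, ?_⟩ ⟨p, hp, rfl⟩
  rintro n ⟨q, hq, rfl⟩
  exact hq.length_lt.le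

theorem detourDist_le {V : Type*} {G : SimpleGraph V} {u v : V} {b : ℕ}
    (h : ∀ p : G.Walk u v, p.IsPath → p.length ≤ b) : detourDist G u v ≤ b := by
  refine csSup_le' ?_
  rintro n ⟨q, hq, rfl⟩
  exact h q hq

/-! ### Span bounds from vertex weights, for general graphs -/

/-- Twice the sum of a sequence, minus its two end terms, is the sum over consecutive pairs. -/
theorem sum_consecutive_pairs (f : ℕ → ℤ) (N : ℕ) :
    ∑ j ∈ Finset.range N, (f j + f (j + 1)) =
      2 * ∑ j ∈ Finset.range (N + 1), f j - f 0 - f N := by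
  induction N with
  | zero => simp; ring
  | succ N ih => rw [Finset.sum_range_succ, ih, Finset.sum_range_succ _ (N + 1)]; ring

/-- A lower bound for the span of a hamiltonian coloring of a graph whose detour distances are
bounded by a sum of vertex weights and a constant. -/
theorem IsHamiltonianColoring.le_sup {V : Type*} [Fintype V] {G : SimpleGraph V} {c : V → ℕ}
    (hc : IsHamiltonianColoring G c) (L : V → ℕ) {M N b : ℕ} (hN : Fintype.card V = N + 1)
    (hN0 : 1 ≤ N)
    (hD : ∀ u v, u ≠ v → detourDist G u v ≤ L u + L v + M)
    (hb : ∀ u v, u ≠ v → b ≤ L u + L v) :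
    (N : ℤ) * (N - M) - 2 * ∑ v, (L v : ℤ) + b ≤ (Finset.univ.sup c : ℕ) := by
  classical
  let e₀ : Fin (N + 1) ≃ V := (Fintype.equivFinOfCardEq hN).symm
  -- Enumerate the vertices by non-decreasing color, so that the absolute values can be dropped.
  let e : Fin (N + 1) ≃ V := (Tuple.sort (c ∘ e₀)).trans e₀
  have hmono : Monotone (c ∘ e) := Tuple.monotone_sort (c ∘ e₀)
  let u : ℕ → V := fun i => e (Fin.ofNat (N + 1) i)
  have hu : ∀ i (hi : i < N + 1), u i = e ⟨i, hi⟩ := by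
    intro i hi
    simp only [u]
    congr 1
    ext
    simp [Nat.mod_eq_of_lt hi]
  have hstep : ∀ j ∈ Finset.range N,
      (N : ℤ) - M - ((L (u j) : ℤ) + L (u (j + 1))) ≤ (c (u (j + 1)) : ℤ) - c (u j) := by
    intro j hj
    rw [Finset.mem_range] at hj
    rw [hu j (by omega), hu (j + 1) (by omega)]
    have hne : e ⟨j, hj.trans N.lt_succ_self⟩ ≠ e ⟨j + 1, Nat.succ_lt_succ hj⟩ := by
      intro h
      have := e.injective h
      simp at this
    have h1 := hc _ _ hne
    have h2 := hD _ _ hne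
    have h3 : c (e ⟨j, hj.trans N.lt_succ_self⟩) ≤ c (e ⟨j + 1, Nat.succ_lt_succ hj⟩) :=
      hmono (by simp)
    rw [hN, abs_of_nonpos (by omega)] at h1
    push_cast at h1
    omega
  have hsum := Finset.sum_le_sum hstep
  rw [Finset.sum_range_sub (fun j => (c (u j) : ℤ)), Finset.sum_sub_distrib,
    sum_consecutive_pairs (fun j => (L (u j) : ℤ))] at hsum
  have htot : ∑ j ∈ Finset.range (N + 1), (L (u j) : ℤ) = ∑ v, (L v : ℤ) := by
    rw [Finset.sum_range, ← e.sum_comp]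
    exact Finset.sum_congr rfl fun i _ => by rw [hu i i.2]
  -- The ends of the order are distinct vertices because N ≥ 1, so together they weigh at least b.
  have hends := hb (u 0) (u N) (by
    rw [hu 0 (by omega), hu N (by omega)]
    intro h
    have := e.injective h
    simp at this
    omega)
  have hsup : c (u N) ≤ Finset.univ.sup c := Finset.le_sup (Finset.mem_univ _)
  rw [htot] at hsum
  simp only [Finset.sum_const, Finset.card_range, nsmul_eq_mul] at hsum
  have : (b : ℤ) ≤ L (u 0) + L (u N) := by exact_mod_cast hends
  have : (c (u N) : ℤ) ≤ (Finset.univ.sup c : ℕ) := by exact_mod_cast hsup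
  have : (0 : ℤ) ≤ c (u 0) := by positivity
  linarith

/-- An ordering of the vertices in which vertices at small positional distance are far apart in
the detour distance yields a hamiltonian coloring. -/
theorem exists_isHamiltonianColoring {V : Type*} [Fintype V] {G : SimpleGraph V}
    (L pos : V → ℕ) {M N P X : ℕ} (hN : Fintype.card V = N + 1) (hNP : N = P + M)
    (hpos : Function.Injective pos) (hlt : ∀ v, pos v < N + 1)
    (hX : ∀ v, L v ≤ X) (hXP : 2 * X ≤ P) (hXP' : 6 * X + M ≤ 2 * P + 2)
    (h1 : ∀ u v, pos v = pos u + 1 → L u + L v + M ≤ detourDist G u v)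
    (h2 : ∀ u v, pos v = pos u + 2 → L u + L v + M + 2 * X ≤ detourDist G u v + P)
    (h3 : ∀ u v, u ≠ v → L u + L v + 2 ≤ detourDist G u v + 2 * X)
    {a z : V} (ha : pos a = 0) (hz : pos z = N) :
    ∃ c : V → ℕ, IsHamiltonianColoring G c ∧
      ((Finset.univ.sup c : ℕ) : ℤ) = N * (N - M) - 2 * ∑ v, (L v : ℤ) + L a + L z := by
  classical
  let f : V → Fin (N + 1) := fun v => ⟨pos v, hlt v⟩
  have hf : Function.Bijective f := by
    rw [Fintype.bijective_iff_injective_and_card]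
    refine ⟨fun u v h => hpos (by simpa [f] using h), by simp [hN]⟩
  let e : Fin (N + 1) ≃ V := (Equiv.ofBijective f hf).symm
  have he : ∀ v, e ⟨pos v, hlt v⟩ = v := fun v => (Equiv.ofBijective f hf).symm_apply_apply v
  let u : ℕ → V := fun i => e (Fin.ofNat (N + 1) i)
  have hu : ∀ v, u (pos v) = v := by
    intro v
    conv_rhs => rw [← he v]
    simp only [u]
    congr 1
    ext
    simp [Nat.mod_eq_of_lt (hlt v)]
  -- The color gap that makes the lower bound tight. The subtraction does not truncate, since
  -- weights are at most X and 2 * X ≤ P.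
  let g : ℕ → ℕ := fun j => P - (L (u j) + L (u (j + 1)))
  have hg : ∀ j, g j + (L (u j) + L (u (j + 1))) = P := by
    intro j
    have := hX (u j)
    have := hX (u (j + 1))
    simp only [g]
    omega
  let F : ℕ → ℕ := fun i => ∑ j ∈ Finset.range i, g j
  have hF : ∀ i, F (i + 1) = F i + g i := fun i => Finset.sum_range_succ _ _
  have hFm : Monotone F := monotone_nat_of_le_succ fun i => by rw [hF]; omega
  have key : ∀ x y, pos x < pos y →
      N ≤ detourDist G x y + (F (pos y) - F (pos x)) := by
    intro x y hxy
    obtain ⟨d, hd⟩ := Nat.exists_eq_add_of_lt hxy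
    have hx := hu x
    have hy := hu y
    have a0 := hg (pos x)
    have a1 := hg (pos x + 1)
    have b0 := hF (pos x)
    have b1 := hF (pos x + 1)
    -- At position distance one the gap is exact. At distance two the middle weight is bounded by X
    -- and `h2` applies. From three on, the first two gaps and the last one suffice: they leave 3P -
    -- 4X minus the end weights, whence the condition 6X + M ≤ 2P + 2.
    rcases d with _ | _ | d
    · have := h1 x y (by omega)
      rw [hd] at hy ⊢
      simp only [add_zero] at hy ⊢
      rw [hx, hy] at a0
      omega
    · have h2' := h2 x y (by omega)
      have hy' : u (pos x + 1 + 1) = y := by rw [← hy]; congr 1; omega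
      have e1 : pos y = pos x + 1 + 1 := by omega
      rw [e1]
      rw [hy'] at a1
      rw [hx] at a0
      have := hX (u (pos x + 1))
      omega
    · have h3' := h3 x y (by rintro rfl; omega)
      have hy' : u (pos x + 1 + (d + 1) + 1) = y := by rw [← hy]; congr 1; omega
      have e1 : pos y = pos x + 1 + (d + 1) + 1 := by omega
      have a2 := hg (pos x + 1 + (d + 1))
      have b2 := hF (pos x + 1 + (d + 1))
      have b3 : F (pos x + 1 + 1) ≤ F (pos x + 1 + (d + 1)) := hFm (by omega)
      rw [e1]
      rw [hy'] at a2
      rw [hx] at a0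
      have := hX (u (pos x + 1))
      have := hX (u (pos x + 1 + 1))
      have := hX (u (pos x + 1 + (d + 1)))
      omega
  refine ⟨fun v => F (pos v), ?_, ?_⟩
  · intro x y hxy
    rcases lt_trichotomy (pos x) (pos y) with h | h | h
    · have h4 := key x y h
      have h5 := hFm h.le
      dsimp only
      rw [hN, abs_of_nonpos (by omega)]
      push_cast
      omega
    · exact absurd (hpos h) hxy
    · have h4 := key y x h
      have h5 := hFm h.le
      rw [detourDist_comm] at h4
      dsimp only
      rw [hN, abs_of_nonneg (by omega)]
      push_cast
      omega
  · have hsup : (Finset.univ.sup fun v => F (pos v)) = F N := by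
      refine le_antisymm (Finset.sup_le fun v _ => hFm (by have := hlt v; omega)) ?_
      rw [← hz]
      exact Finset.le_sup (f := fun v => F (pos v)) (Finset.mem_univ z)
    have hcast : (F N : ℤ) = ∑ j ∈ Finset.range N, ((P : ℤ) - ((L (u j) : ℤ) + L (u (j + 1)))) := by
      simp only [F]
      push_cast
      refine Finset.sum_congr rfl fun j _ => ?_
      have := hg j
      omega
    have htot : ∑ j ∈ Finset.range (N + 1), (L (u j) : ℤ) = ∑ v, (L v : ℤ) := by
      rw [Finset.sum_range, ← e.sum_comp]
      refine Finset.sum_congr rfl fun i _ => ?_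
      simp only [u]
      congr 3
      ext
      simp
    rw [hsup, hcast, Finset.sum_sub_distrib, sum_consecutive_pairs (fun j => (L (u j) : ℤ)), htot,
      ← ha, ← hz, hu a, hu z]
    simp only [Finset.sum_const, Finset.card_range, nsmul_eq_mul, hz]
    rw [hNP]
    push_cast
    ring

/-- The hamiltonian chromatic number is determined by a matching pair of bounds. -/
theorem hamiltonianChromaticNumber_eq {V : Type*} [Fintype V] {G : SimpleGraph V} {s : ℤ}
    (hle : ∀ c, IsHamiltonianColoring G c → s ≤ (Finset.univ.sup c : ℕ))
    (hex : ∃ c, IsHamiltonianColoring G c ∧ ((Finset.univ.sup c : ℕ) : ℤ) = s) :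
    (hamiltonianChromaticNumber G : ℤ) = s := by
  obtain ⟨c, hc, rfl⟩ := hex
  have : IsLeast {s : ℕ | ∃ c : V → ℕ, IsHamiltonianColoring G c ∧ Finset.univ.sup c = s}
      (Finset.univ.sup c) := by
    refine ⟨⟨c, hc, rfl⟩, ?_⟩
    rintro _ ⟨d, hd, rfl⟩
    exact_mod_cast hle d hd
  rw [hamiltonianChromaticNumber, this.csInf_eq]

/-! ### Coordinates of vertices, ancestors and descendants -/

namespace LevelVertex

variable {w r : ℕ} {k m : ℕ → ℕ}

/-- The step `i + 1` on the way to `u` as a pair of natural numbers, `(0, 0)` from the level of `u`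
on. -/
def st (u : LevelVertex w r k m) (i : ℕ) : ℕ × ℕ :=
  if h : i < u.level then ((u.step i h).1, (u.step i h).2) else (0, 0)

/-- Passing to `st` removes the dependence of the type of a step on level bounds, so steps of
different vertices can be compared in ℕ × ℕ. -/
theorem st_eq_iff {u v : LevelVertex w r k m} {i : ℕ} (hu : i < u.level) (hv : i < v.level) :
    u.st i = v.st i ↔ u.step i hu = v.step i hv := by
  simp [st, hu, hv, Prod.ext_iff, Fin.ext_iff]

theorem st_fst_eq_iff {u v : LevelVertex w r k m} {i : ℕ} (hu : i < u.level) (hv : i < v.level) :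
    (u.st i).1 = (v.st i).1 ↔ (u.step i hu).1 = (v.step i hv).1 := by
  simp [st, hu, hv, Fin.ext_iff]

theorem st_fst_lt {u : LevelVertex w r k m} {i : ℕ} (hu : i < u.level) :
    (u.st i).1 < k (i + 1) := by
  simp [st, hu]

theorem st_snd_lt {u : LevelVertex w r k m} {i : ℕ} (hu : i < u.level) :
    (u.st i).2 < m (i + 1) := by
  simp [st, hu]

theorem level_le (u : LevelVertex w r k m) : u.level ≤ r := Nat.lt_succ_iff.mp u.1.2

theorem ext_st {u v : LevelVertex w r k m} (hl : u.level = v.level) (hr : u.root = v.root)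
    (hs : ∀ i < u.level, u.st i = v.st i) : u = v := by
  obtain ⟨l, a, f⟩ := u
  obtain ⟨l', a', f'⟩ := v
  obtain rfl : l = l' := Fin.ext hl
  obtain rfl : a = a' := hr
  congr 2
  funext i
  have := hs i i.2
  rwa [st_eq_iff i.2 i.2] at this

/-- The vertex of level `l` with central vertex `a` and steps prescribed by `f`. -/
def mkSt (l : ℕ) (hl : l ≤ r) (a : Fin w) (f : ℕ → ℕ × ℕ)
    (hf : ∀ i < l, (f i).1 < k (i + 1) ∧ (f i).2 < m (i + 1)) : LevelVertex w r k m :=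
  ⟨⟨l, Nat.lt_succ_iff.mpr hl⟩, a, fun i => (⟨(f i).1, (hf i i.2).1⟩, ⟨(f i).2, (hf i i.2).2⟩)⟩

section mkSt

variable {l : ℕ} {hl : l ≤ r} {a : Fin w} {f : ℕ → ℕ × ℕ}
  {hf : ∀ i < l, (f i).1 < k (i + 1) ∧ (f i).2 < m (i + 1)}

@[simp] theorem level_mkSt : (mkSt l hl a f hf).level = l := rfl

@[simp] theorem root_mkSt : (mkSt l hl a f hf).root = a := rfl

theorem st_mkSt {i : ℕ} (hi : i < l) : (mkSt l hl a f hf).st i = f i := by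
  have : i < (mkSt l hl a f hf).level := hi
  simp only [st, this, dif_pos]
  rfl

end mkSt

/-- `u` and `v` have the same central vertex and the same first `a` steps. -/
def Agree (a : ℕ) (u v : LevelVertex w r k m) : Prop :=
  u.root = v.root ∧ ∀ i < a, u.st i = v.st i

theorem Agree.refl (a : ℕ) (u : LevelVertex w r k m) : Agree a u u := ⟨rfl, fun _ _ => rfl⟩

theorem Agree.symm {a : ℕ} {u v : LevelVertex w r k m} (h : Agree a u v) : Agree a v u :=
  ⟨h.1.symm, fun i hi => (h.2 i hi).symm⟩

theorem Agree.trans {a : ℕ} {u v x : LevelVertex w r k m} (h : Agree a u v) (h' : Agree a v x) :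
    Agree a u x :=
  ⟨h.1.trans h'.1, fun i hi => (h.2 i hi).trans (h'.2 i hi)⟩

theorem Agree.mono {a b : ℕ} {u v : LevelVertex w r k m} (h : Agree b u v) (hab : a ≤ b) :
    Agree a u v :=
  ⟨h.1, fun i hi => h.2 i (hi.trans_le hab)⟩

theorem Agree.succ {a : ℕ} {u v : LevelVertex w r k m} (h : Agree a u v) (h' : u.st a = v.st a) :
    Agree (a + 1) u v := by
  refine ⟨h.1, fun i hi => ?_⟩
  rcases Nat.lt_succ_iff_lt_or_eq.mp hi with hi | rfl
  · exact h.2 i hi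
  · exact h'

theorem Agree.eq {u v : LevelVertex w r k m} (h : Agree u.level u v) (hl : u.level = v.level) :
    u = v := ext_st hl h.1 h.2

/-- The ancestor of `u` of level `a`. -/
def anc (u : LevelVertex w r k m) (a : ℕ) (ha : a ≤ u.level) : LevelVertex w r k m :=
  mkSt a (ha.trans u.level_le) u.root u.st fun _ hi =>
    ⟨st_fst_lt (hi.trans_le ha), st_snd_lt (hi.trans_le ha)⟩

@[simp] theorem level_anc (u : LevelVertex w r k m) (a : ℕ) (ha : a ≤ u.level) :
    (u.anc a ha).level = a := rfl

theorem agree_anc (u : LevelVertex w r k m) (a : ℕ) (ha : a ≤ u.level) :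
    Agree a (u.anc a ha) u := ⟨rfl, fun _ hi => st_mkSt hi⟩

theorem anc_level (u : LevelVertex w r k m) : u.anc u.level le_rfl = u :=
  (u.agree_anc u.level le_rfl).eq rfl

theorem isChild_iff {u v : LevelVertex w r k m} :
    u.IsChild v ↔ v.level = u.level + 1 ∧ Agree u.level v u := by
  unfold IsChild Agree
  refine and_congr_right fun h => and_congr_right fun _ => ?_
  refine forall_congr' fun i => ⟨fun h' hu => ?_, fun h' hu hv => ?_⟩
  · exact (st_eq_iff (by omega) hu).mpr (h' hu (by omega))
  · exact (st_eq_iff (by omega) hu).mp (h' hu)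

theorem isSibling_iff {u v : LevelVertex w r k m} :
    u.IsSibling v ↔ u ≠ v ∧ ∃ l, u.level = l + 1 ∧ v.level = l + 1 ∧ Agree l u v ∧
      (u.st l).1 = (v.st l).1 := by
  unfold IsSibling
  refine and_congr_right fun _ => ?_
  constructor
  · rintro ⟨h1, l, hu, hv, h2, h3⟩
    exact ⟨l, hu, hv, ⟨h1, fun i hi => (st_eq_iff (by omega) (by omega)).mpr (h2 i hi)⟩,
      (st_fst_eq_iff (by omega) (by omega)).mpr h3⟩
  · rintro ⟨l, hu, hv, ⟨h1, h2⟩, h3⟩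
    exact ⟨h1, l, hu, hv, fun i hi => (st_eq_iff (by omega) (by omega)).mp (h2 i hi),
      (st_fst_eq_iff (by omega) (by omega)).mp h3⟩

/-- The sum of the numbers `m i` over the levels `1, …, l`. -/
def levelSum (m : ℕ → ℕ) (l : ℕ) : ℕ := ∑ i ∈ Finset.range l, m (i + 1)

/-- The length of a longest path from `u` to its central vertex. -/
def depth (u : LevelVertex w r k m) : ℕ := levelSum m u.level

theorem levelSum_mono (m : ℕ → ℕ) : Monotone (levelSum m) := fun _ _ h =>
  Finset.sum_le_sum_of_subset (Finset.range_subset_range.mpr h)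

theorem levelSum_succ (m : ℕ → ℕ) (l : ℕ) : levelSum m (l + 1) = levelSum m l + m (l + 1) :=
  Finset.sum_range_succ _ _

theorem depth_le (u : LevelVertex w r k m) : u.depth ≤ levelSum m r :=
  levelSum_mono m u.level_le

/-- `y` is a descendant of a vertex in the block below level `l` that contains `x`: it agrees
with `x` in the first `l` steps and in the block chosen in step `l + 1`. -/
def BlockBelow (l : ℕ) (x y : LevelVertex w r k m) : Prop :=
  l < y.level ∧ Agree l y x ∧ (y.st l).1 = (x.st l).1

end LevelVertex

open LevelVertex

/-! ### Upper bound for the detour distance -/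

section LevelGraph

variable {w r : ℕ} {k m : ℕ → ℕ}

theorem levelGraph_adj {u v : LevelVertex w r k m} :
    (levelGraph w r k m).Adj u v ↔ u ≠ v ∧ ((u.level = 0 ∧ v.level = 0) ∨ u.IsChild v ∨
      v.IsChild u ∨ u.IsSibling v) := by
  rw [levelGraph, SimpleGraph.fromRel_adj]
  refine and_congr_right fun _ => ?_
  have : v.IsSibling u → u.IsSibling v := by
    rw [isSibling_iff, isSibling_iff]
    rintro ⟨h, l, h1, h2, h3, h4⟩
    exact ⟨h.symm, l, h2, h1, h3.symm, h4.symm⟩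
  tauto

/-- The only neighbour outside of the descendants of a block is the vertex to which the block is
attached. -/
theorem eq_anc_of_adj_blockBelow {l : ℕ} {x y z : LevelVertex w r k m} (hx : l < x.level)
    (hy : BlockBelow l x y) (hz : ¬ BlockBelow l x z) (h : (levelGraph w r k m).Adj y z) :
    z = x.anc l hx.le := by
  obtain ⟨hy1, hy2, hy3⟩ := hy
  obtain ⟨-, h | h | h | h⟩ := levelGraph_adj.mp h
  · omega
  · rw [isChild_iff] at h
    refine absurd ⟨by omega, (h.2.mono hy1.le).trans hy2, ?_⟩ hz
    rw [h.2.2 l hy1, hy3]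
  · rw [isChild_iff] at h
    rcases (by omega : l < z.level ∨ z.level = l) with h' | h'
    · refine absurd ⟨h', (h.2.mono h'.le).symm.trans hy2, ?_⟩ hz
      rw [← h.2.2 l h', hy3]
    · refine Agree.eq ?_ h'
      rw [h'] at h ⊢
      exact (h.2.symm.trans hy2).trans (x.agree_anc l hx.le).symm
  · obtain ⟨-, l', h1, h2, h3, h4⟩ := isSibling_iff.mp h
    rcases (by omega : l < l' ∨ l = l') with h' | rfl
    · refine absurd ⟨by omega, (h3.mono h'.le).symm.trans hy2, ?_⟩ hz
      rw [← h3.2 l h', hy3]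
    · exact absurd ⟨by omega, h3.symm.trans hy2, h4.symm.trans hy3⟩ hz

/-- A path that leaves the descendants of a block on one side contains the vertex to which the
block is attached. -/
theorem anc_mem_support {l : ℕ} {x y z : LevelVertex w r k m} (hx : l < x.level)
    (hy : BlockBelow l x y) (hz : ¬ BlockBelow l x z) (p : (levelGraph w r k m).Walk y z) :
    x.anc l hx.le ∈ p.support := by
  obtain ⟨d, hd, h1, h2⟩ := p.exists_boundary_dart {y | BlockBelow l x y} hy hz
  rw [← eq_anc_of_adj_blockBelow hx h1 h2 d.adj]
  exact p.dart_snd_mem_support_of_mem_darts hd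

/-- If neither end lay below the block of x, the path would have to enter and leave the part below
that block through its attachment vertex, visiting it both before and after x. -/
theorem blockBelow_of_mem_support {u v x : LevelVertex w r k m} {l : ℕ} (hx : x.level = l + 1)
    {p : (levelGraph w r k m).Walk u v} (hp : p.IsPath) (hmem : x ∈ p.support) :
    BlockBelow l x u ∨ BlockBelow l x v := by
  classical
  by_contra! hcon
  have hlt : l < x.level := by omega
  have hself : BlockBelow l x x := ⟨hlt, Agree.refl _ _, rfl⟩
  have h1 := anc_mem_support hlt hself hcon.1 (p.takeUntil x hmem).reverse
  have h2 := anc_mem_support hlt hself hcon.2 (p.dropUntil x hmem)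
  rw [SimpleGraph.Walk.support_reverse, List.mem_reverse] at h1
  have hne : x.anc l hlt.le ≠ x := by
    intro h
    have := congrArg level h
    rw [level_anc] at this
    omega
  have h3 : x.anc l hlt.le ∈ (p.dropUntil x hmem).support.tail := by
    rw [← SimpleGraph.Walk.cons_tail_support] at h2
    exact (List.mem_cons.mp h2).resolve_left hne
  have hnd := hp.support_nodup
  rw [← p.take_spec hmem, SimpleGraph.Walk.support_append] at hnd
  exact (List.nodup_append.mp hnd).2.2 _ h1 _ h3 rfl

/-- The number of vertices lying in the blocks that connect `u` to its central vertex. -/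
theorem card_blockBelow_le (u : LevelVertex w r k m) (s : Finset (LevelVertex w r k m))
    (hs : ∀ x ∈ s, ∃ l, x.level = l + 1 ∧ BlockBelow l x u) : s.card ≤ u.depth := by
  classical
  have : u.depth = ((Finset.range u.level).sigma fun i => Finset.range (m (i + 1))).card := by
    simp [depth, levelSum]
  rw [this]
  -- The steps of u fix everything about x except its level and its place within the block.
  refine Finset.card_le_card_of_injOn (fun x => ⟨x.level - 1, (x.st (x.level - 1)).2⟩) ?_ ?_
  · intro x hx
    obtain ⟨l, hl, h1, -⟩ := hs x hx
    have e : x.level - 1 = l := by omega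
    simp only [e, Finset.coe_sigma, Set.mem_sigma_iff, Finset.coe_range, Set.mem_Iio]
    exact ⟨h1, st_snd_lt (by omega)⟩
  · intro x hx y hy hxy
    obtain ⟨l, hl, h1, h2, h3⟩ := hs x hx
    obtain ⟨l', hl', h1', h2', h3'⟩ := hs y hy
    simp only [hl, hl', Nat.add_sub_cancel, Sigma.mk.injEq] at hxy
    obtain ⟨rfl, h4⟩ := hxy
    refine Agree.eq ?_ (hl.trans hl'.symm)
    rw [hl]
    exact (h2.symm.trans h2').succ (Prod.ext (h3.symm.trans h3') (eq_of_heq h4))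

theorem card_level_zero_le (s : Finset (LevelVertex w r k m)) (hs : ∀ x ∈ s, x.level = 0) :
    s.card ≤ w := by
  refine (Finset.card_le_card_of_injOn (t := Finset.univ) root
    (fun _ _ => Finset.mem_coe.mpr (Finset.mem_univ _)) ?_).trans (Finset.card_fin w).le
  intro x hx y hy hxy
  exact ext_st ((hs x hx).trans (hs y hy).symm) hxy (by rw [hs x hx]; omega)

/-- Count vertices: each one on the path is central or lies in a block of the chain of u or of v. -/
theorem length_succ_le_of_isPath {u v : LevelVertex w r k m} {p : (levelGraph w r k m).Walk u v}
    (hp : p.IsPath) : p.length + 1 ≤ u.depth + v.depth + w := by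
  classical
  rw [← p.length_support, ← List.toFinset_card_of_nodup hp.support_nodup]
  set s := p.support.toFinset with hs
  let s₀ := s.filter fun x => x.level = 0
  let s₁ := s.filter fun x => ∃ l, x.level = l + 1 ∧ BlockBelow l x u
  let s₂ := s.filter fun x => ∃ l, x.level = l + 1 ∧ BlockBelow l x v
  have hsub : s ⊆ s₁ ∪ s₂ ∪ s₀ := by
    intro x hx
    rcases Nat.eq_zero_or_eq_succ_pred x.level with h | h
    · exact Finset.mem_union_right _ (Finset.mem_filter.mpr ⟨hx, h⟩)
    · refine Finset.mem_union_left _ ?_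
      rcases blockBelow_of_mem_support h hp (List.mem_toFinset.mp hx) with h' | h'
      · exact Finset.mem_union_left _ (Finset.mem_filter.mpr ⟨hx, _, h, h'⟩)
      · exact Finset.mem_union_right _ (Finset.mem_filter.mpr ⟨hx, _, h, h'⟩)
  have h0 : s₀.card ≤ w := card_level_zero_le _ fun x hx => (Finset.mem_filter.mp hx).2
  have h1 : s₁.card ≤ u.depth := card_blockBelow_le u _ fun x hx => (Finset.mem_filter.mp hx).2
  have h2 : s₂.card ≤ v.depth := card_blockBelow_le v _ fun x hx => (Finset.mem_filter.mp hx).2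
  have h3 := Finset.card_le_card hsub
  have h4 := Finset.card_union_le (s₁ ∪ s₂) s₀
  have h5 := Finset.card_union_le s₁ s₂
  omega

theorem detourDist_levelGraph_le {M : ℕ} (u v : LevelVertex (M + 1) r k m) :
    detourDist (levelGraph (M + 1) r k m) u v ≤ u.depth + v.depth + M :=
  detourDist_le fun p hp => by
    have := length_succ_le_of_isPath hp
    omega

end LevelGraph

/-! ### Paths of prescribed length inside a set -/

/-- There is a path from `u` to `v` of length at least `d` whose vertices lie in `S`. -/
def HasLongPath {V : Type*} (G : SimpleGraph V) (S : Set V) (d : ℕ) (u v : V) : Prop :=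
  ∃ p : G.Walk u v, p.IsPath ∧ d ≤ p.length ∧ ∀ x ∈ p.support, x ∈ S

namespace HasLongPath

variable {V : Type*} {G : SimpleGraph V} {S T : Set V} {d e : ℕ} {u v x : V}

theorem le_detourDist [Fintype V] (h : HasLongPath G S d u v) : d ≤ detourDist G u v := by
  obtain ⟨p, hp, hd, -⟩ := h
  exact hd.trans hp.length_le_detourDist

theorem nil (hu : u ∈ S) : HasLongPath G S 0 u u :=
  ⟨.nil, .nil, le_rfl, by simpa using hu⟩

theorem symm (h : HasLongPath G S d u v) : HasLongPath G S d v u := by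
  obtain ⟨p, hp, hd, hS⟩ := h
  exact ⟨p.reverse, hp.reverse, by simpa using hd, fun x hx => hS x (by simpa using hx)⟩

theorem mono (h : HasLongPath G S d u v) (hST : S ⊆ T) (hed : e ≤ d) : HasLongPath G T e u v := by
  obtain ⟨p, hp, hd, hS⟩ := h
  exact ⟨p, hp, hed.trans hd, fun x hx => hST (hS x hx)⟩

/-- This is why the confining sets are carried along: if they meet only in the junction, the
concatenation is again a path. -/
theorem trans (h : HasLongPath G S d u v) (h' : HasLongPath G T e v x)
    (hST : ∀ y ∈ S, y ∈ T → y = v) : HasLongPath G (S ∪ T) (d + e) u x := by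
  obtain ⟨p, hp, hd, hS⟩ := h
  obtain ⟨q, hq, he, hT⟩ := h'
  refine ⟨p.append q, ?_, ?_, ?_⟩
  · rw [SimpleGraph.Walk.isPath_def, SimpleGraph.Walk.support_append, List.nodup_append]
    refine ⟨hp.support_nodup, hq.support_nodup.tail, ?_⟩
    rintro a ha _ hb rfl
    obtain rfl := hST a (hS a ha) (hT a (List.mem_of_mem_tail hb))
    have := hq.support_nodup
    rw [← q.cons_tail_support] at this
    exact (List.nodup_cons.mp this).1 hb
  · rw [SimpleGraph.Walk.length_append]
    omega
  · intro y hy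
    rcases (SimpleGraph.Walk.mem_support_append_iff _ _).mp hy with hy | hy
    · exact Or.inl (hS y hy)
    · exact Or.inr (hT y hy)

theorem of_adj (h : G.Adj u v) : HasLongPath G {u, v} 1 u v :=
  ⟨.cons h .nil, by simp [h.ne], by simp, by simp⟩

/-- Two vertices of a clique are joined by a path through all vertices of the clique. -/
theorem of_isClique [DecidableEq V] (n : ℕ) : ∀ (K : Finset V) (u v : V), u ∈ K → v ∈ K → u ≠ v →
    G.IsClique (K : Set V) → n + 1 ≤ K.card → HasLongPath G K n u v := by
  induction n with
  | zero =>
    intro K u v hu hv huv hK _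
    refine (of_adj (hK hu hv huv)).mono ?_ (Nat.zero_le _)
    rintro x (rfl | rfl)
    exacts [hu, hv]
  | succ n ih =>
    intro K u v hu hv huv hK hn
    rcases n with _ | n
    · refine (of_adj (hK hu hv huv)).mono ?_ le_rfl
      rintro x (rfl | rfl)
      exacts [hu, hv]
    -- Step from u to a third vertex x, then traverse the clique without u.
    · obtain ⟨x, hx⟩ : ((K.erase u).erase v).Nonempty := by
        rw [← Finset.card_pos, Finset.card_erase_of_mem (by simp [huv.symm, hv]),
          Finset.card_erase_of_mem hu]
        omega
      simp only [Finset.mem_erase] at hx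
      have h1 := ih (K.erase u) x v (by simp [hx]) (by simp [huv.symm, hv]) hx.1
        (hK.subset (by simp)) (by rw [Finset.card_erase_of_mem hu]; omega)
      have h2 : HasLongPath G {u, x} 1 u x := of_adj (hK hu hx.2.2 hx.2.1.symm)
      refine (h2.trans h1 ?_).mono ?_ (by omega)
      · rintro y (rfl | rfl) hy
        · simp at hy
        · rfl
      · rintro y ((rfl | rfl) | hy)
        · exact hu
        · exact hx.2.2
        · simp only [Finset.coe_erase, Set.mem_sdiff] at hy
          exact hy.1

end HasLongPath

/-! ### Lower bounds for the detour distance -/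

section LongPath

variable {w r : ℕ} {k m : ℕ → ℕ}

open Classical in
/-- The block below level `l` through which the path from a central vertex to `u` leads. -/
noncomputable def pathBlock (u : LevelVertex w r k m) (l : ℕ) (hl : l < u.level) :
    Finset (LevelVertex w r k m) :=
  insert (u.anc l hl.le) (Finset.univ.filter fun x => x.level = l + 1 ∧ BlockBelow l u x)

theorem mem_pathBlock {u x : LevelVertex w r k m} {l : ℕ} {hl : l < u.level} :
    x ∈ pathBlock u l hl ↔ x = u.anc l hl.le ∨ (x.level = l + 1 ∧ BlockBelow l u x) := by
  classical
  simp [pathBlock]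

theorem le_card_pathBlock (u : LevelVertex w r k m) (l : ℕ) (hl : l < u.level) :
    m (l + 1) + 1 ≤ (pathBlock u l hl).card := by
  classical
  rw [pathBlock, Finset.card_insert_of_notMem (by simp), Nat.add_le_add_iff_right]
  let f : Fin (m (l + 1)) → LevelVertex w r k m := fun j =>
    mkSt (l + 1) (hl.trans_le u.level_le) u.root
      (fun i => if i = l then ((u.st l).1, j) else u.st i) (by
        intro i hi
        by_cases h : i = l
        · subst h
          simpa using st_fst_lt hl
        · rw [if_neg h]
          exact ⟨st_fst_lt (by omega), st_snd_lt (by omega)⟩)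
  refine (Finset.card_fin _).symm.le.trans
    (Finset.card_le_card_of_injOn (s := Finset.univ) f ?_ ?_)
  · intro j _
    have hst : ∀ i < l + 1, (f j).st i = if i = l then ((u.st l).1, (j : ℕ)) else u.st i :=
      fun i hi => st_mkSt hi
    simp only [Finset.coe_filter, Finset.mem_univ, true_and, Set.mem_ofPred_eq]
    refine ⟨rfl, Nat.lt_succ_self l, ⟨rfl, fun i hi => ?_⟩, ?_⟩
    · rw [hst i (by omega), if_neg hi.ne]
    · rw [hst l (by omega), if_pos rfl]
  · intro i _ j _ hij
    have := congrArg (fun x => (x.st l).2) hij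
    simp only [f, st_mkSt (Nat.lt_succ_self l), if_true] at this
    exact Fin.ext this

theorem adj_of_blockBelow {x y : LevelVertex w r k m} {l : ℕ} (hx : x.level = l + 1)
    (hy : y.level = l + 1) (h : Agree l x y) (h' : (x.st l).1 = (y.st l).1) (hne : x ≠ y) :
    (levelGraph w r k m).Adj x y :=
  levelGraph_adj.mpr ⟨hne, .inr (.inr (.inr (isSibling_iff.mpr ⟨hne, l, hx, hy, h, h'⟩)))⟩

theorem adj_anc_of_agree {x u : LevelVertex w r k m} {l : ℕ} (hl : l ≤ u.level)
    (hx : x.level = l + 1) (h : Agree l x u) :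
    (levelGraph w r k m).Adj (u.anc l hl) x := by
  refine levelGraph_adj.mpr ⟨?_, .inr (.inl (isChild_iff.mpr ⟨hx, ?_⟩))⟩
  · rintro rfl
    simp at hx
  · exact h.trans (u.agree_anc l hl).symm

theorem isClique_pathBlock (u : LevelVertex w r k m) (l : ℕ) (hl : l < u.level) :
    (levelGraph w r k m).IsClique (pathBlock u l hl : Set (LevelVertex w r k m)) := by
  intro x hx y hy hxy
  rcases mem_pathBlock.mp (Finset.mem_coe.mp hx) with rfl | ⟨hx1, hx2⟩ <;>
    rcases mem_pathBlock.mp (Finset.mem_coe.mp hy) with rfl | ⟨hy1, hy2⟩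
  · exact absurd rfl hxy
  · exact adj_anc_of_agree _ hy1 hy2.2.1
  · exact (adj_anc_of_agree _ hx1 hx2.2.1).symm
  · exact adj_of_blockBelow hx1 hy1 (hx2.2.1.trans hy2.2.1.symm) (hx2.2.2.trans hy2.2.2.symm) hxy

theorem hasLongPath_pathBlock {u x y : LevelVertex w r k m} {l : ℕ} {hl : l < u.level}
    (hx : x ∈ pathBlock u l hl) (hy : y ∈ pathBlock u l hl) (hxy : x ≠ y) :
    HasLongPath (levelGraph w r k m) (pathBlock u l hl) (m (l + 1)) x y := by
  classical
  exact HasLongPath.of_isClique _ _ _ _ hx hy hxy (isClique_pathBlock u l hl)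
    (le_card_pathBlock u l hl)

/-- The ancestor of `u` of level `a` and the vertices below it in the direction of `u`. -/
def branchSet (u : LevelVertex w r k m) (a : ℕ) (ha : a ≤ u.level) : Set (LevelVertex w r k m) :=
  {x | x = u.anc a ha ∨ (a < u.level ∧ BlockBelow a u x)}

theorem agree_of_mem_branchSet {u x : LevelVertex w r k m} {a : ℕ} {ha : a ≤ u.level}
    (hx : x ∈ branchSet u a ha) : Agree a x u := by
  rcases hx with rfl | ⟨-, hx⟩
  · exact u.agree_anc a ha
  · exact hx.2.1

/-- A longest path from a vertex to one of its ancestors. -/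
theorem hasLongPath_anc (u : LevelVertex w r k m) (d : ℕ) : ∀ (a : ℕ) (ha : a ≤ u.level),
    a + d = u.level →
    HasLongPath (levelGraph w r k m) (branchSet u a ha) (u.depth - levelSum m a) u
      (u.anc a ha) := by
  induction d with
  | zero =>
    intro a ha h
    obtain rfl : a = u.level := h
    rw [depth, Nat.sub_self]
    conv => arg 4; rw [← u.anc_level]
    exact HasLongPath.nil (Or.inl rfl)
  | succ d ih =>
    intro a ha h
    have ha' : a < u.level := by omega
    have hc1 : BlockBelow a u (u.anc (a + 1) ha') :=
      ⟨Nat.lt_succ_self a, (u.agree_anc _ _).mono (Nat.le_succ a),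
        congrArg Prod.fst ((u.agree_anc (a + 1) ha').2 a (Nat.lt_succ_self a))⟩
    have h1 := ih (a + 1) ha' (by omega)
    have h2 := hasLongPath_pathBlock (hl := ha') (x := u.anc (a + 1) ha') (y := u.anc a ha)
      (mem_pathBlock.mpr (.inr ⟨rfl, hc1⟩)) (mem_pathBlock.mpr (.inl rfl)) (by
        intro h
        have := congrArg level h
        simp at this)
    refine (h1.trans h2 ?_).mono ?_ ?_
    · rintro y (rfl | ⟨-, hy⟩) hy'
      · rfl
      · have := hy.1
        rcases mem_pathBlock.mp (Finset.mem_coe.mp hy') with rfl | ⟨hy', -⟩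
        · rw [level_anc] at this
          omega
        · omega
    · rintro y ((rfl | ⟨-, hy⟩) | hy)
      · exact .inr ⟨ha', hc1⟩
      · exact .inr ⟨ha', (Nat.lt_succ_self a).trans hy.1, hy.2.1.mono (Nat.le_succ a),
          congrArg Prod.fst (hy.2.1.2 a (Nat.lt_succ_self a))⟩
      · rcases mem_pathBlock.mp (Finset.mem_coe.mp hy) with rfl | ⟨-, hy⟩
        · exact .inl rfl
        · exact .inr ⟨ha', hy⟩
    · have : levelSum m (a + 1) ≤ u.depth := levelSum_mono m ha'
      rw [levelSum_succ] at this ⊢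
      omega

theorem hasLongPath_root (u : LevelVertex w r k m) :
    HasLongPath (levelGraph w r k m) (branchSet u 0 (Nat.zero_le _)) u.depth u
      (u.anc 0 (Nat.zero_le _)) :=
  hasLongPath_anc u u.level 0 (Nat.zero_le _) (Nat.zero_add _)

theorem anc_zero_eq {u v : LevelVertex w r k m} (h : u.root = v.root) :
    u.anc 0 (Nat.zero_le _) = v.anc 0 (Nat.zero_le _) :=
  ext_st rfl h fun i hi => absurd hi (Nat.not_lt_zero i)

theorem adj_of_level_zero {u v : LevelVertex w r k m} (hu : u.level = 0) (hv : v.level = 0)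
    (h : u ≠ v) : (levelGraph w r k m).Adj u v :=
  levelGraph_adj.mpr ⟨h, .inl ⟨hu, hv⟩⟩

theorem hasLongPath_level_zero {M : ℕ} {u v : LevelVertex (M + 1) r k m} (hu : u.level = 0)
    (hv : v.level = 0) (h : u ≠ v) :
    HasLongPath (levelGraph (M + 1) r k m) {x | x.level = 0} M u v := by
  classical
  refine (HasLongPath.of_isClique M (Finset.univ.filter fun x => x.level = 0) u v (by simp [hu])
    (by simp [hv]) h ?_ ?_).mono (by simp) le_rfl
  · intro x hx y hy hxy
    simp only [Finset.coe_filter, Finset.mem_univ, true_and, Set.mem_ofPred_eq] at hx hy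
    exact adj_of_level_zero hx hy hxy
  · let f : Fin (M + 1) → LevelVertex (M + 1) r k m := fun a =>
      mkSt 0 (Nat.zero_le _) a (fun _ => (0, 0)) fun i hi => absurd hi (Nat.not_lt_zero i)
    refine (Finset.card_fin _).symm.le.trans
      (Finset.card_le_card_of_injOn (s := Finset.univ) f ?_ ?_)
    · intro a _
      simp [f]
    · intro a _ b _ hab
      exact congrArg root hab

/-- Descend from u to the centre through whole blocks, traverse the whole central clique, and climb
to v. This attains the upper bound. -/
theorem le_detourDist_of_root_ne {M : ℕ} {u v : LevelVertex (M + 1) r k m} (h : u.root ≠ v.root) :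
    u.depth + v.depth + M ≤ detourDist (levelGraph (M + 1) r k m) u v := by
  have hne : u.anc 0 (Nat.zero_le _) ≠ v.anc 0 (Nat.zero_le _) := fun h' =>
    h (show (u.anc 0 (Nat.zero_le _)).root = (v.anc 0 (Nat.zero_le _)).root by rw [h'])
  have h1 := (hasLongPath_root u).trans (hasLongPath_level_zero (M := M) rfl rfl hne) (by
    rintro y (rfl | ⟨-, hy⟩) hy'
    · rfl
    · exact absurd hy.1 (by simp only [Set.mem_ofPred_eq] at hy'; omega))
  have h2 := (h1.trans (hasLongPath_root v).symm (by
    rintro y (hy | hy) hy'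
    · exact absurd ((agree_of_mem_branchSet hy).symm.trans (agree_of_mem_branchSet hy')).1 h
    · rcases hy' with rfl | ⟨-, hy'⟩
      · rfl
      · exact absurd hy'.1 (by simp only [Set.mem_ofPred_eq] at hy; omega))).le_detourDist
  omega

/-- The two chains meet only in the common central vertex, so the full descents can be joined there.
For a single central vertex this attains the upper bound. -/
theorem le_detourDist_of_block_ne {u v : LevelVertex w r k m} (hr : u.root = v.root)
    (h : 0 < u.level → 0 < v.level → (u.st 0).1 ≠ (v.st 0).1) :
    u.depth + v.depth ≤ detourDist (levelGraph w r k m) u v := by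
  have h2 := (hasLongPath_root v).symm
  rw [← anc_zero_eq hr] at h2
  refine ((hasLongPath_root u).trans h2 ?_).le_detourDist
  rintro y (rfl | ⟨hu, hy⟩) (hy' | ⟨hv, hy'⟩)
  · rfl
  · rfl
  · exact hy'.trans (anc_zero_eq hr).symm
  · exact absurd (hy.2.2.symm.trans hy'.2.2) (h hu hv)

/-- When the first blocks coincide, stop both descents at level one and cross by a single edge of
the shared block. This crude path loses 2 * m 1 - 1, which is affordable at position distance two.
-/
theorem le_detourDist_of_st_zero_ne {u v : LevelVertex w r k m} (hr : u.root = v.root)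
    (h : 0 < u.level → 0 < v.level → u.st 0 ≠ v.st 0) :
    u.depth + v.depth + 1 ≤ detourDist (levelGraph w r k m) u v + 2 * m 1 ∨
      u.depth + v.depth ≤ detourDist (levelGraph w r k m) u v := by
  by_cases h' : 0 < u.level → 0 < v.level → (u.st 0).1 ≠ (v.st 0).1
  · exact .inr (le_detourDist_of_block_ne hr h')
  · push Not at h'
    obtain ⟨hu, hv, hb⟩ := h'
    have hs := h hu hv
    have hau := (u.agree_anc 1 hu).2 0 one_pos
    have hav := (v.agree_anc 1 hv).2 0 one_pos
    have h1 := hasLongPath_anc u (u.level - 1) 1 hu (by omega)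
    have h2 := hasLongPath_anc v (v.level - 1) 1 hv (by omega)
    have hadj : (levelGraph w r k m).Adj (u.anc 1 hu) (v.anc 1 hv) := by
      refine adj_of_blockBelow (l := 0) rfl rfl ⟨hr, fun i hi => absurd hi (Nat.not_lt_zero i)⟩ ?_ ?_
      · rw [hau, hav, hb]
      · intro heq
        rw [heq, hav] at hau
        exact hs hau.symm
    have h3 := (h1.trans (HasLongPath.of_adj hadj) (by
      rintro y hy (rfl | rfl)
      · rfl
      · exact absurd ((agree_of_mem_branchSet hy).2 0 one_pos) (by rw [hav]; exact hs.symm)))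
    have h4 := (h3.trans h2.symm (by
      rintro y (hy | (rfl | rfl)) hy'
      · exact absurd (((agree_of_mem_branchSet hy).symm.trans (agree_of_mem_branchSet hy')).2 0
          one_pos) hs
      · exact absurd ((agree_of_mem_branchSet hy').2 0 one_pos) (by rw [hau]; exact hs)
      · rfl)).le_detourDist
    have e : levelSum m 1 = m 1 := by simp [levelSum]
    rw [e] at h4
    exact .inl (by omega)

theorem levelGraph_reachable (u v : LevelVertex w r k m) : (levelGraph w r k m).Reachable u v := by
  obtain ⟨p, -⟩ := hasLongPath_root u
  obtain ⟨q, -⟩ := hasLongPath_root v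
  refine p.reachable.trans (SimpleGraph.Reachable.trans ?_ q.reachable.symm)
  by_cases h : u.anc 0 (Nat.zero_le _) = v.anc 0 (Nat.zero_le _)
  · rw [h]
  · exact (adj_of_level_zero rfl rfl h).reachable

/-- Distinct vertices, not both of them central, are joined by a path of length at least two. -/
theorem two_le_detourDist (hm : ∀ i, 1 ≤ i → i ≤ r → 2 ≤ m i) {u v : LevelVertex w r k m}
    (h : u ≠ v) (h0 : 0 < u.level ∨ 0 < v.level) :
    2 ≤ detourDist (levelGraph w r k m) u v := by
  have child : ∀ {x y : LevelVertex w r k m}, x.IsChild y →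
      2 ≤ detourDist (levelGraph w r k m) x y := by
    intro x y hxy
    obtain ⟨hl, ha⟩ := isChild_iff.mp hxy
    have hlt : x.level < y.level := by omega
    have hx : x = y.anc x.level hlt.le :=
      (ha.symm.trans (y.agree_anc _ _).symm).eq rfl
    -- A path through all of the common block has length m (l + 1) ≥ 2.
    refine (hm (x.level + 1) (by omega) (by have := y.level_le; omega)).trans
      (hasLongPath_pathBlock (hl := hlt) (mem_pathBlock.mpr (.inl hx))
        (mem_pathBlock.mpr (.inr ⟨hl, hlt, Agree.refl _ _, rfl⟩)) ?_).le_detourDist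
    rintro rfl
    exact absurd hlt (lt_irrefl _)
  by_cases hadj : (levelGraph w r k m).Adj u v
  · obtain ⟨-, h' | h' | h' | h'⟩ := levelGraph_adj.mp hadj
    · omega
    · exact child h'
    · rw [detourDist_comm]
      exact child h'
    · obtain ⟨-, l, h1, h2, h3, h4⟩ := isSibling_iff.mp h'
      have hlt : l < u.level := by omega
      exact (hm (l + 1) (by omega) (by have := u.level_le; omega)).trans
        (hasLongPath_pathBlock (hl := hlt)
          (mem_pathBlock.mpr (.inr ⟨h1, hlt, Agree.refl _ _, rfl⟩))
          (mem_pathBlock.mpr (.inr ⟨h2, by omega, h3.symm, h4.symm⟩)) h).le_detourDist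
  · obtain ⟨p, hp⟩ := (levelGraph_reachable u v).exists_isPath
    refine le_trans ?_ hp.length_le_detourDist
    by_contra! hlt
    rcases (by omega : p.length = 0 ∨ p.length = 1) with h' | h'
    · exact h (SimpleGraph.Walk.eq_of_length_eq_zero h')
    · exact hadj (SimpleGraph.Walk.adj_of_length_eq_one h')

end LongPath

/-! ### Counting vertices and the cyclic order -/

namespace LevelVertex

/-- The number of vertices of level `l` above each central vertex. -/
def levelCard (k m : ℕ → ℕ) (l : ℕ) : ℕ := ∏ j ∈ Finset.range l, k (j + 1) * m (j + 1)

theorem sum_level (w r : ℕ) (k m f : ℕ → ℕ) :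
    ∑ v : LevelVertex w r k m, f v.level =
      w * ∑ l ∈ Finset.range (r + 1), levelCard k m l * f l := by
  rw [Fintype.sum_sigma, Finset.mul_sum, Finset.sum_range]
  refine Finset.sum_congr rfl fun l _ => ?_
  have : ∀ y, f (level (⟨l, y⟩ : LevelVertex w r k m)) = f l := fun _ => rfl
  simp only [this, Finset.sum_const, Finset.card_univ, Fintype.card_prod, Fintype.card_pi,
    Fintype.card_fin, smul_eq_mul, levelCard, Finset.prod_range, mul_assoc]

theorem card_eq (w r : ℕ) (k m : ℕ → ℕ) :
    Fintype.card (LevelVertex w r k m) = w * ∑ l ∈ Finset.range (r + 1), levelCard k m l := by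
  simpa using sum_level w r k m fun _ => 1

/-- Splitting off the first step shows that the non-central vertices fall into classes of equal
size, one for each central vertex and first step. -/
theorem levelCard_succ (k m : ℕ → ℕ) (l : ℕ) :
    levelCard k m (l + 1) = k 1 * m 1 * levelCard (fun i => k (i + 1)) (fun i => m (i + 1)) l := by
  rw [levelCard, Finset.prod_range_succ', mul_comm]
  rfl

variable {M s : ℕ} {k m : ℕ → ℕ}

/-- The steps after the first one on the way to a vertex that is not central. -/
def tail (u : LevelVertex (M + 1) (s + 1) k m) :
    LevelVertex 1 s (fun i => k (i + 1)) (fun i => m (i + 1)) :=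
  mkSt (u.level - 1) (by have := u.level_le; omega) 0 (fun i => u.st (i + 1)) fun i hi =>
    ⟨st_fst_lt (by omega), st_snd_lt (by omega)⟩

/-- The position of a vertex in a linear order in which the central vertices, the blocks attached
to them and the vertices of these blocks alternate cyclically; `q` numbers the vertices with the
same first step. -/
def pos (q : LevelVertex 1 s (fun i => k (i + 1)) (fun i => m (i + 1)) → ℕ) (P : ℕ)
    (u : LevelVertex (M + 1) (s + 1) k m) : ℕ :=
  if 0 < u.level then
    1 + (u.root + (M + 1) * ((u.st 0).1 + k 1 * ((u.st 0).2 + m 1 * q u.tail)))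
  -- One central vertex opens the order and the others close it, so that for M > 0 both ends have
  -- depth zero.
  else if (u.root : ℕ) = M then 0 else 1 + P + u.root

theorem mixedRadix_lt {a b w B : ℕ} (ha : a < w) (hb : b < B) : a + w * b < w * B := by
  have : w * (b + 1) ≤ w * B := Nat.mul_le_mul_left _ hb
  rw [mul_add, mul_one] at this
  omega

theorem mixedRadix_inj {a b a' b' w : ℕ} (ha : a < w) (ha' : a' < w)
    (h : a + w * b = a' + w * b') : a = a' ∧ b = b' := by
  have h1 : a = a' := by
    have := congrArg (· % w) h
    simpa [Nat.add_mul_mod_self_left, Nat.mod_eq_of_lt ha, Nat.mod_eq_of_lt ha'] using this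
  subst h1
  exact ⟨rfl, Nat.eq_of_mul_eq_mul_left (by omega) (Nat.add_left_cancel h)⟩

variable {q : LevelVertex 1 s (fun i => k (i + 1)) (fun i => m (i + 1)) → ℕ} {P T : ℕ}

theorem pos_of_pos_level {u : LevelVertex (M + 1) (s + 1) k m} (hu : 0 < u.level) :
    pos q P u =
      1 + (u.root + (M + 1) * ((u.st 0).1 + k 1 * ((u.st 0).2 + m 1 * q u.tail))) := if_pos hu

theorem pos_of_level_eq_zero {u : LevelVertex (M + 1) (s + 1) k m} (hu : ¬ 0 < u.level) :
    pos q P u = if (u.root : ℕ) = M then 0 else 1 + P + u.root := if_neg hu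

theorem pos_le_of_pos_level (hq : ∀ x, q x < T) (hP : P = (M + 1) * (k 1 * (m 1 * T)))
    {u : LevelVertex (M + 1) (s + 1) k m} (hu : 0 < u.level) : pos q P u ≤ P := by
  have := mixedRadix_lt u.root.2 (mixedRadix_lt (st_fst_lt hu)
    (mixedRadix_lt (st_snd_lt hu) (hq u.tail)))
  rw [pos_of_pos_level hu, hP]
  simp only [Nat.zero_add] at this
  omega

theorem pos_lt (hq : ∀ x, q x < T) (hP : P = (M + 1) * (k 1 * (m 1 * T)))
    (u : LevelVertex (M + 1) (s + 1) k m) : pos q P u < P + M + 1 := by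
  by_cases hu : 0 < u.level
  · have := pos_le_of_pos_level hq hP hu
    omega
  · have := u.root.2
    rw [pos_of_level_eq_zero hu]
    split_ifs <;> omega

theorem tail_inj {u v : LevelVertex (M + 1) (s + 1) k m} (hu : 0 < u.level) (hv : 0 < v.level)
    (hr : u.root = v.root) (h0 : u.st 0 = v.st 0) (h : u.tail = v.tail) : u = v := by
  have hl : u.level = v.level := by
    have := congrArg level h
    simp only [tail, level_mkSt] at this
    omega
  refine ext_st hl hr fun i hi => ?_
  rcases i with _ | i
  · exact h0
  · have := congrArg (fun x => x.st i) h
    simp only [tail] at this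
    rwa [st_mkSt (by omega), st_mkSt (by omega)] at this

theorem pos_injective (hqi : Function.Injective q) (hq : ∀ x, q x < T)
    (hP : P = (M + 1) * (k 1 * (m 1 * T))) :
    Function.Injective (pos (M := M) q P) := by
  intro u v h
  by_cases hu : 0 < u.level <;> by_cases hv : 0 < v.level
  · rw [pos_of_pos_level hu, pos_of_pos_level hv] at h
    obtain ⟨h1, h⟩ := mixedRadix_inj u.root.2 v.root.2 (Nat.add_left_cancel h)
    obtain ⟨h2, h⟩ := mixedRadix_inj (st_fst_lt hu) (st_fst_lt hv) h
    obtain ⟨h3, h⟩ := mixedRadix_inj (st_snd_lt hu) (st_snd_lt hv) h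
    exact tail_inj hu hv (Fin.ext h1) (Prod.ext h2 h3) (hqi h)
  · have h1 := pos_le_of_pos_level hq hP hu
    rw [h, pos_of_level_eq_zero hv] at h1
    split_ifs at h1 with h2
    · rw [pos_of_pos_level hu, pos_of_level_eq_zero hv, if_pos h2] at h
      omega
    · omega
  · have h1 := pos_le_of_pos_level hq hP hv
    rw [← h, pos_of_level_eq_zero hu] at h1
    split_ifs at h1 with h2
    · rw [pos_of_pos_level hv, pos_of_level_eq_zero hu, if_pos h2] at h
      omega
    · omega
  · rw [pos_of_level_eq_zero hu, pos_of_level_eq_zero hv] at h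
    refine ext_st (by omega) (Fin.ext ?_) (by omega)
    split_ifs at h <;> omega

/-- The central vertex is the lowest mixed-radix digit. The central vertices themselves fit the
pattern, because M + 1 divides P and index M at position 0 gives 1 + M ≡ 0. -/
theorem pos_modEq (hP : P = (M + 1) * (k 1 * (m 1 * T))) (u : LevelVertex (M + 1) (s + 1) k m) :
    pos q P u ≡ 1 + u.root [MOD M + 1] := by
  by_cases hu : 0 < u.level
  · rw [pos_of_pos_level hu, ← add_assoc]
    exact Nat.add_mul_mod_self_left _ _ _
  · rw [pos_of_level_eq_zero hu]
    split_ifs with h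
    · rw [h, add_comm 1 M]
      exact (Nat.modEq_zero_iff_dvd.mpr dvd_rfl).symm
    · rw [hP, add_right_comm]
      exact Nat.add_mul_mod_self_left _ _ _

/-- Vertices with the same central vertex have positions congruent modulo the number of central
vertices. -/
theorem dvd_of_root_eq (hP : P = (M + 1) * (k 1 * (m 1 * T)))
    {u v : LevelVertex (M + 1) (s + 1) k m} {d : ℕ} (h : pos q P v = pos q P u + d)
    (hr : u.root = v.root) : M + 1 ∣ d := by
  have h1 := pos_modEq (q := q) hP u
  have h2 := pos_modEq (q := q) hP v
  rw [h, ← hr] at h2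
  have h3 : pos q P u + d ≡ pos q P u + 0 [MOD M + 1] := h2.trans h1.symm
  exact Nat.modEq_zero_iff_dvd.mp (Nat.ModEq.add_left_cancel' _ h3)

/-- Agreement in the two lowest digits leaves a multiple of their combined radix; the next lemma
adds the third digit. -/
theorem dvd_of_st_fst_eq {u v : LevelVertex (M + 1) (s + 1) k m} {d : ℕ}
    (h : pos q P v = pos q P u + d) (hr : u.root = v.root) (hu : 0 < u.level) (hv : 0 < v.level)
    (h0 : (u.st 0).1 = (v.st 0).1) : (M + 1) * k 1 ∣ d := by
  rw [pos_of_pos_level hu, pos_of_pos_level hv, hr, h0] at h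
  have e : (M + 1) * k 1 * ((u.st 0).2 + m 1 * q u.tail) + d =
      (M + 1) * k 1 * ((v.st 0).2 + m 1 * q v.tail) := by linarith
  exact (Nat.dvd_add_right (Dvd.intro _ rfl)).mp (Dvd.intro _ e.symm)

theorem dvd_of_st_eq {u v : LevelVertex (M + 1) (s + 1) k m} {d : ℕ}
    (h : pos q P v = pos q P u + d) (hr : u.root = v.root) (hu : 0 < u.level) (hv : 0 < v.level)
    (h0 : u.st 0 = v.st 0) : (M + 1) * k 1 * m 1 ∣ d := by
  rw [pos_of_pos_level hu, pos_of_pos_level hv, hr, h0] at h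
  have e : (M + 1) * k 1 * m 1 * q u.tail + d = (M + 1) * k 1 * m 1 * q v.tail := by linarith
  exact (Nat.dvd_add_right (Dvd.intro _ rfl)).mp (Dvd.intro _ e.symm)

end LevelVertex

/-! ### Matching the two bounds -/

/-- The hamiltonian chromatic number of a level-wise regular block graph with `M + 1` central
vertices, `P` other vertices and `s + 1` levels. -/
theorem hamiltonianChromaticNumber_levelGraph {M s P : ℕ} {k m : ℕ → ℕ}
    (hP : P = (M + 1) * ∑ l ∈ Finset.range (s + 1), levelCard k m (l + 1))
    (hk1 : 1 ≤ k 1) (hm : ∀ i, 1 ≤ i → i ≤ s + 1 → 2 ≤ m i)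
    (hwk : M = 0 → 2 ≤ k 1) (h3 : 3 ≤ (M + 1) * k 1 * m 1)
    (hX : 2 * levelSum m (s + 1) ≤ P) (hX' : 6 * levelSum m (s + 1) + M ≤ 2 * P + 2)
    (hC : 2 ≤ M ∨ (M = 0 ∧ 3 ≤ k 1) ∨ 2 * levelSum m (s + 1) + 2 * m 1 + M ≤ P + 1) :
    (hamiltonianChromaticNumber (levelGraph (M + 1) (s + 1) k m) : ℤ) =
      (P + M) * P - 2 * ∑ v : LevelVertex (M + 1) (s + 1) k m, (v.depth : ℤ) +
        (if M = 0 then m 1 else 0 : ℕ) := by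
  classical
  have hm1 : 2 ≤ m 1 := hm 1 le_rfl (by omega)
  have hcard : Fintype.card (LevelVertex (M + 1) (s + 1) k m) = P + M + 1 := by
    rw [card_eq, Finset.sum_range_succ', mul_add, ← hP]
    simp [levelCard, add_assoc]
  have hXm : m 1 ≤ levelSum m (s + 1) := by
    have := levelSum_mono m (show 1 ≤ s + 1 by omega)
    simpa [levelSum] using this
  have hdepth : ∀ v : LevelVertex (M + 1) (s + 1) k m, 0 < v.level → m 1 ≤ v.depth := by
    intro v hv
    have := levelSum_mono m (show 1 ≤ v.level from hv)
    simpa [levelSum, depth] using this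
  refine hamiltonianChromaticNumber_eq (fun c hc => ?_) ?_
  · have := hc.le_sup (fun v => v.depth) (M := M) (N := P + M) (b := if M = 0 then m 1 else 0)
      hcard (by omega) (fun u v _ => detourDist_levelGraph_le u v) ?_
    · refine le_trans (le_of_eq ?_) this
      push_cast
      ring
    -- With one central vertex, at least one of two distinct vertices is non-central and so has
    -- depth at least m 1.
    · intro u v huv
      split_ifs with h0
      · subst h0
        by_cases hu : 0 < u.level
        · exact (hdepth u hu).trans (Nat.le_add_right _ _)
        by_cases hv : 0 < v.level
        · exact (hdepth v hv).trans (Nat.le_add_left _ _)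
        exact absurd (ext_st (by omega) (Fin.ext (by have := u.root.2; have := v.root.2; omega))
          (by omega)) huv
      · exact Nat.zero_le _
  · set R := LevelVertex 1 s (fun i => k (i + 1)) (fun i => m (i + 1)) with hR
    let T := Fintype.card R
    have hPT : P = (M + 1) * (k 1 * (m 1 * T)) := by
      rw [hP]
      simp only [T, hR, card_eq, levelCard_succ, ← Finset.mul_sum]
      ring
    let x₀ : R := mkSt 0 (Nat.zero_le _) 0 (fun _ => (0, 0)) fun i hi => absurd hi (Nat.not_lt_zero i)
    have hT : 0 < T := Fintype.card_pos_iff.mpr ⟨x₀⟩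
    -- Numbering the trivial tail last puts, for M = 0, a vertex of level one at the final position,
    -- where it contributes exactly m 1.
    obtain ⟨e, he⟩ : ∃ e : R ≃ Fin T, e x₀ = ⟨T - 1, by omega⟩ := by
      let e := Fintype.equivFin R
      exact ⟨e.trans (Equiv.swap (e x₀) ⟨T - 1, by omega⟩), by simp⟩
    let q : R → ℕ := fun x => e x
    have hq : ∀ x, q x < T := fun x => (e x).2
    have hqi : Function.Injective q := fun x y h => e.injective (Fin.ext h)
    let a : LevelVertex (M + 1) (s + 1) k m :=
      mkSt 0 (Nat.zero_le _) (Fin.last M) (fun _ => (0, 0)) fun i hi => absurd hi (Nat.not_lt_zero i)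
    have ha : pos q P a = 0 := by
      rw [pos_of_level_eq_zero (by simp [a])]
      simp [a]
    obtain ⟨z, hz, hz'⟩ : ∃ z : LevelVertex (M + 1) (s + 1) k m, pos q P z = P + M ∧
        z.depth = if M = 0 then m 1 else 0 := by
      rcases Nat.eq_zero_or_pos M with h0 | h0
      · subst h0
        let z : LevelVertex (0 + 1) (s + 1) k m := mkSt 1 (by omega) 0
          (fun _ => (k 1 - 1, m 1 - 1)) (by
            intro i hi
            obtain rfl : i = 0 := by omega
            constructor <;> simp only [zero_add] <;> omega)
        have hst : z.st 0 = (k 1 - 1, m 1 - 1) := st_mkSt one_pos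
        have htail : z.tail = x₀ := ext_st rfl rfl fun i hi => absurd hi (Nat.not_lt_zero i)
        refine ⟨z, ?_, by simp [z, depth, levelSum]⟩
        rw [pos_of_pos_level (show 0 < z.level from one_pos), hst, htail, hPT]
        have hqx : q x₀ = T - 1 := by simp only [q, he]
        have hr0 : ((z.root : Fin (0 + 1)) : ℕ) = 0 := rfl
        rw [hqx, hr0]
        obtain ⟨t, ht⟩ := Nat.exists_eq_add_of_lt hT
        obtain ⟨κ, hκ⟩ := Nat.exists_eq_add_of_le hk1
        obtain ⟨μ, hμ⟩ := Nat.exists_eq_add_of_le hm1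
        rw [ht, hκ, hμ]
        have e1 : 1 + κ - 1 = κ := by omega
        have e2 : 2 + μ - 1 = 1 + μ := by omega
        have e3 : 0 + t + 1 - 1 = t := by omega
        rw [e1, e2, e3]
        ring
      · refine ⟨mkSt 0 (Nat.zero_le _) ⟨M - 1, by omega⟩ (fun _ => (0, 0))
          fun i hi => absurd hi (Nat.not_lt_zero i), ?_, ?_⟩
        · rw [pos_of_level_eq_zero (by simp), root_mkSt]
          rw [if_neg (show ¬ M - 1 = M by omega)]
          simp only
          omega
        · rw [if_neg (by omega)]
          simp [depth, levelSum]
    have ha' : a.depth = 0 := by simp [a, depth, levelSum]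
    have hnext : ∀ u v : LevelVertex (M + 1) (s + 1) k m, pos q P v = pos q P u + 1 →
        u.depth + v.depth + M ≤ detourDist (levelGraph (M + 1) (s + 1) k m) u v := by
      intro u v huv
      by_cases hr : u.root = v.root
      · have hM : M = 0 := by
          have := Nat.le_of_dvd one_pos (dvd_of_root_eq hPT huv hr)
          omega
        subst hM
        have := le_detourDist_of_block_ne hr fun hu hv h0 => by
          have := Nat.le_of_dvd one_pos (dvd_of_st_fst_eq huv hr hu hv h0)
          have := hwk rfl
          omega
        simpa using this
      · exact le_detourDist_of_root_ne hr
    have hnext2 : ∀ u v : LevelVertex (M + 1) (s + 1) k m, pos q P v = pos q P u + 2 →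
        u.depth + v.depth + M + 2 * levelSum m (s + 1) ≤
          detourDist (levelGraph (M + 1) (s + 1) k m) u v + P := by
      intro u v huv
      by_cases hr : u.root = v.root
      · have hM := Nat.le_of_dvd two_pos (dvd_of_root_eq hPT huv hr)
        -- A common central vertex at position distance two is impossible for M ≥ 2. If M = 0 and k
        -- 1 ≥ 3, the blocks differ. Otherwise the first steps differ, since the period (M + 1) * k
        -- 1 * m 1 exceeds two, and P absorbs the possible loss.
        rcases hC with hC | ⟨hM0, hk3⟩ | hC
        · omega
        · subst hM0
          have := le_detourDist_of_block_ne hr fun hu hv h0 => by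
            have := Nat.le_of_dvd two_pos (dvd_of_st_fst_eq huv hr hu hv h0)
            omega
          omega
        · have := le_detourDist_of_st_zero_ne hr fun hu hv h0 => by
            have := Nat.le_of_dvd two_pos (dvd_of_st_eq huv hr hu hv h0)
            omega
          omega
      · have := le_detourDist_of_root_ne hr
        omega
    have hdist : ∀ u v : LevelVertex (M + 1) (s + 1) k m, u ≠ v →
        u.depth + v.depth + 2 ≤
          detourDist (levelGraph (M + 1) (s + 1) k m) u v + 2 * levelSum m (s + 1) := by
      intro u v huv
      by_cases h0 : 0 < u.level ∨ 0 < v.level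
      · have := two_le_detourDist hm huv h0
        have := u.depth_le
        have := v.depth_le
        omega
      · have hu : u.depth = 0 := by
          rw [depth, show u.level = 0 by omega]
          rfl
        have hv : v.depth = 0 := by
          rw [depth, show v.level = 0 by omega]
          rfl
        omega
    obtain ⟨c, hc, hsup⟩ := exists_isHamiltonianColoring (G := levelGraph (M + 1) (s + 1) k m)
      (fun v => v.depth) (pos q P) (M := M) (N := P + M) (X := levelSum m (s + 1)) hcard rfl
      (pos_injective hqi hq hPT) (pos_lt hq hPT) depth_le hX hX' hnext hnext2 hdist ha hz
    refine ⟨c, hc, hsup.trans ?_⟩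
    rw [ha', hz']
    push_cast
    ring

/-! ### Numerical inequalities and the final formulas -/

/-- The number of vertices of the levels `1, …, r` when one block is attached to each vertex. -/
def prodSum (m : ℕ → ℕ) (r : ℕ) : ℕ :=
  ∑ l ∈ Finset.range r, ∏ j ∈ Finset.range (l + 1), m (j + 1)

theorem prodSum_succ (m : ℕ → ℕ) (r : ℕ) :
    prodSum m (r + 1) = prodSum m r + (∏ j ∈ Finset.range r, m (j + 1)) * m (r + 1) := by
  rw [prodSum, Finset.sum_range_succ, Finset.prod_range_succ]
  rfl

theorem two_le_prod_range (m : ℕ → ℕ) {r : ℕ} (hr : 1 ≤ r)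
    (hm : ∀ i, 1 ≤ i → i ≤ r → 2 ≤ m i) : 2 ≤ ∏ j ∈ Finset.range r, m (j + 1) := by
  induction r, hr using Nat.le_induction with
  | base => simpa using hm 1 le_rfl le_rfl
  | succ r hr ih =>
    rw [Finset.prod_range_succ]
    have h1 := ih fun i hi hi' => hm i hi (by omega)
    have h2 := hm (r + 1) (by omega) le_rfl
    nlinarith

theorem levelSum_le_prodSum (m : ℕ → ℕ) (r : ℕ) (hm : ∀ i, 1 ≤ i → i ≤ r → 2 ≤ m i) :
    levelSum m r ≤ prodSum m r := by
  induction r with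
  | zero => simp [levelSum]
  | succ r ih =>
    have h1 := ih fun i hi hi' => hm i hi (by omega)
    rw [levelSum_succ, prodSum_succ]
    rcases Nat.eq_zero_or_pos r with rfl | hr
    · simpa using h1
    · have h2 := two_le_prod_range m hr fun i hi hi' => hm i hi (by omega)
      nlinarith

/-- Both inequalities are equalities for r = 2, m 1 = m 2 = 2, and both fail for r = 1, where the
sums coincide; hence the separate hypotheses in that case. -/
theorem levelSum_add_le_prodSum (m : ℕ → ℕ) {r : ℕ} (hr : 2 ≤ r)
    (hm : ∀ i, 1 ≤ i → i ≤ r → 2 ≤ m i) :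
    levelSum m r + m 1 ≤ prodSum m r ∧ 3 * levelSum m r ≤ 2 * prodSum m r := by
  induction r, hr using Nat.le_induction with
  | base =>
    have h1 := hm 1 le_rfl (by omega)
    have h2 := hm 2 (by omega) le_rfl
    obtain ⟨a, ha⟩ := Nat.exists_eq_add_of_le h1
    obtain ⟨b, hb⟩ := Nat.exists_eq_add_of_le h2
    simp only [levelSum, prodSum, Finset.sum_range_succ, Finset.prod_range_succ,
      Finset.sum_range_zero, Finset.prod_range_zero, zero_add, one_mul, one_add_one_eq_two, ha, hb]
    constructor <;> nlinarith
  | succ r hr ih =>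
    obtain ⟨h1, h2⟩ := ih fun i hi hi' => hm i hi (by omega)
    have h3 := two_le_prod_range m (by omega : 1 ≤ r) fun i hi hi' => hm i hi (by omega)
    rw [levelSum_succ, prodSum_succ]
    constructor <;> nlinarith

/-- Every level product contains the factor k 1, and the remaining k j are at least 1. -/
theorem mul_prodSum_le {k m : ℕ → ℕ} {r : ℕ} (hk : ∀ i, 1 ≤ i → i ≤ r → 1 ≤ k i) :
    k 1 * prodSum m r ≤ ∑ l ∈ Finset.range r, levelCard k m (l + 1) := by
  rw [prodSum, Finset.mul_sum]
  refine Finset.sum_le_sum fun l hl => ?_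
  rw [levelCard, Finset.prod_mul_distrib]
  refine Nat.mul_le_mul_right _ ?_
  rw [Finset.prod_range_succ']
  refine Nat.le_mul_of_pos_left _ (Finset.prod_pos fun i hi => ?_)
  rw [Finset.mem_range] at hl hi
  exact hk _ (by omega) (by omega)

theorem levelCard_eq_prod_Icc (k m : ℕ → ℕ) (l : ℕ) :
    (levelCard k m l : ℤ) = ∏ j ∈ Finset.Icc 1 l, (k j : ℤ) * (m j : ℤ) := by
  rw [levelCard, Finset.range_eq_Ico]
  push_cast
  rw [Finset.prod_Ico_add' (fun j => (k j : ℤ) * (m j : ℤ)) 0 l 1]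
  rfl

theorem levelSum_eq_sum_Icc (m : ℕ → ℕ) (l : ℕ) :
    (levelSum m l : ℤ) = ∑ j ∈ Finset.Icc 1 l, (m j : ℤ) := by
  rw [levelSum, Finset.range_eq_Ico]
  push_cast
  rw [Finset.sum_Ico_add' (fun j => (m j : ℤ)) 0 l 1]
  rfl

theorem sum_range_succ_eq_sum_Icc (f : ℕ → ℤ) (r : ℕ) :
    ∑ l ∈ Finset.range r, f (l + 1) = ∑ l ∈ Finset.Icc 1 r, f l := by
  rw [Finset.range_eq_Ico, Finset.sum_Ico_add' f 0 r 1]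
  rfl

theorem sum_depth (M r : ℕ) (k m : ℕ → ℕ) :
    ∑ v : LevelVertex (M + 1) r k m, (v.depth : ℤ) =
      ((M : ℤ) + 1) * ∑ i ∈ Finset.Icc 1 r,
        (∏ j ∈ Finset.Icc 1 i, (k j : ℤ) * (m j : ℤ)) * ∑ j ∈ Finset.Icc 1 i, (m j : ℤ) := by
  have h : ((∑ v : LevelVertex (M + 1) r k m, v.depth : ℕ) : ℤ) = _ :=
    congrArg Nat.cast (sum_level (M + 1) r k m (levelSum m))
  rw [Finset.sum_range_succ'] at h
  push_cast at h
  rw [h, ← sum_range_succ_eq_sum_Icc]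
  simp [levelCard_eq_prod_Icc, levelSum_eq_sum_Icc]

theorem theorem5 (r m : ℕ) (k ms : ℕ → ℕ) (hr : 1 ≤ r) (hm : 1 ≤ m)
    (hk : ∀ i ∈ Finset.Icc 1 r, 1 ≤ k i) (hms : ∀ i ∈ Finset.Icc 1 r, 2 ≤ ms i) :
    -- one central vertex
    (2 ≤ k 1 → (r = 1 → 3 ≤ k 1) →
      (hamiltonianChromaticNumber (levelGraph 1 r k ms) : ℤ) =
        (∑ i ∈ Finset.Icc 1 r, ∏ j ∈ Finset.Icc 1 i, (k j : ℤ) * (ms j : ℤ)) ^ 2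
        - 2 * (∑ i ∈ Finset.Icc 1 r,
            (∏ j ∈ Finset.Icc 1 i, (k j : ℤ) * (ms j : ℤ)) * ∑ j ∈ Finset.Icc 1 i, (ms j : ℤ))
        + (ms 1 : ℤ)) ∧
    -- a central block with m + 1 vertices
    ((r = 1 → 3 ≤ (m + 1) * k 1) →
      (hamiltonianChromaticNumber (levelGraph (m + 1) r k ms) : ℤ) =
        ((m : ℤ) + ((m : ℤ) + 1) *
            ∑ i ∈ Finset.Icc 1 r, ∏ j ∈ Finset.Icc 1 i, (k j : ℤ) * (ms j : ℤ)) *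
          (((m : ℤ) + 1) * ∑ i ∈ Finset.Icc 1 r, ∏ j ∈ Finset.Icc 1 i, (k j : ℤ) * (ms j : ℤ))
        - 2 * (∑ i ∈ Finset.Icc 1 r, ((m : ℤ) + 1) *
            ((∏ j ∈ Finset.Icc 1 i, (k j : ℤ) * (ms j : ℤ)) *
              ∑ j ∈ Finset.Icc 1 i, (ms j : ℤ)))) := by
  have hk' : ∀ i, 1 ≤ i → i ≤ r → 1 ≤ k i := fun i h h' => hk i (Finset.mem_Icc.mpr ⟨h, h'⟩)
  have hms' : ∀ i, 1 ≤ i → i ≤ r → 2 ≤ ms i := fun i h h' => hms i (Finset.mem_Icc.mpr ⟨h, h'⟩)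
  obtain ⟨s, rfl⟩ := Nat.exists_eq_add_of_le' hr
  have hk1 := hk' 1 le_rfl hr
  have hm1 := hms' 1 le_rfl hr
  have hSA := mul_prodSum_le (m := ms) hk'
  have hAX := levelSum_le_prodSum ms (s + 1) hms'
  have hAX' : 1 ≤ s → _ := fun h => levelSum_add_le_prodSum ms (by omega : 2 ≤ s + 1) hms'
  have hX1 : s = 0 → levelSum ms (s + 1) = ms 1 := by
    rintro rfl
    simp [levelSum]
  have hSc : ((∑ l ∈ Finset.range (s + 1), levelCard k ms (l + 1) : ℕ) : ℤ) =
      ∑ i ∈ Finset.Icc 1 (s + 1), ∏ j ∈ Finset.Icc 1 i, (k j : ℤ) * (ms j : ℤ) := by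
    rw [← sum_range_succ_eq_sum_Icc]
    push_cast
    simp only [levelCard_eq_prod_Icc]
  have hmX : ms 1 ≤ levelSum ms (s + 1) := by
    have := levelSum_mono ms hr
    simpa [levelSum] using this
  rw [← hSc]
  -- From here on only inequalities between S, X, A and the parameters matter, chiefly k 1 * A ≤ S
  -- and X ≤ A.
  generalize hS : ∑ l ∈ Finset.range (s + 1), levelCard k ms (l + 1) = S at *
  generalize hX : levelSum ms (s + 1) = X at *
  generalize prodSum ms (s + 1) = A at *
  constructor
  · intro h2 hr3
    have h2A : 2 * A ≤ S := (Nat.mul_le_mul_right A h2).trans hSA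
    have h3A : 3 ≤ k 1 → 3 * A ≤ S := fun h => (Nat.mul_le_mul_right A h).trans hSA
    refine (hamiltonianChromaticNumber_levelGraph (M := 0) (P := S) (by rw [hS]; ring) hk1 hms'
      (fun _ => h2) (by nlinarith) (by omega) ?_ ?_).trans ?_
    · rcases Nat.eq_zero_or_pos s with h0 | h0
      · have := h3A (hr3 (by omega))
        omega
      · have := hAX' h0
        omega
    · rcases Nat.eq_zero_or_pos s with h0 | h0
      · exact .inr (.inl ⟨rfl, hr3 (by omega)⟩)
      · have := hAX' h0
        exact .inr (.inr (by omega))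
    · rw [sum_depth, if_pos rfl]
      push_cast
      ring
  · intro hr3
    have hAS : A ≤ S := (Nat.le_mul_of_pos_left A hk1).trans hSA
    have h2S : 2 * S ≤ (m + 1) * S := Nat.mul_le_mul_right S (by omega)
    have h3 : 3 ≤ (m + 1) * k 1 * ms 1 :=
      (by norm_num : 3 ≤ 2 * 1 * 2).trans
        (Nat.mul_le_mul (Nat.mul_le_mul (by omega) hk1) hm1)
    refine (hamiltonianChromaticNumber_levelGraph (M := m) (P := (m + 1) * S) (by rw [hS]) hk1 hms'
      (by omega) h3 (by omega) ?_ ?_).trans ?_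
    · rcases (by omega : m = 1 ∨ 2 ≤ m) with rfl | h
      · rcases Nat.eq_zero_or_pos s with h0 | h0
        -- For r = 1 and two central vertices, 3 ≤ 2 * k 1 forces k 1 ≥ 2.
        · have h3 : 2 ≤ k 1 := by have := hr3 (by omega); omega
          have := (Nat.mul_le_mul_right A h3).trans hSA
          omega
        · have := hAX' h0
          omega
      · obtain ⟨t, rfl⟩ := Nat.exists_eq_add_of_le h
        nlinarith
    · rcases (by omega : m = 1 ∨ 2 ≤ m) with rfl | h
      · right; right
        rcases Nat.eq_zero_or_pos s with h0 | h0
        · have h3 : 2 ≤ k 1 := by have := hr3 (by omega); omega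
          have := (Nat.mul_le_mul_right A h3).trans hSA
          have := hX1 h0
          omega
        · have := hAX' h0
          omega
      · exact .inl h
    · rw [sum_depth, if_neg (by omega), ← Finset.mul_sum]
      push_cast
      ring
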